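/- **Hardness of learning Haar-random states from $k$-copy quantum statistical queries.** *Notation.* For a set $\mathcal X$, a metric space $(M,d)$, a probability measure $\mu$ on functions $s:\mathcal X\to M$ and $\tau>0$, put, for $f:\mathcal X\to M$, $$\mathrm{frac}(\mu,f,\tau)=\sup_{x\in\mathcal X}\Pr_{s\sim\mu}\big[d(s(x),f(x))>\tau\big],\qquad q_{\mathrm{nt}}[\mu,\tau]=\sup_{f:\mathcal X\to M}\mathrm{frac}(\mu,f,\tau)^{-1}\in[1,\infty],$$ with $0^{-1}=\infty$; $q_{\mathrm{nt}}[\mu,\tau]$ is called the query complexity of non-trivial learning with respect to $\mu$ from evaluation queries of tolerance $\tau$. *Haar-random states and $k$-copy queries.* Let $N,k\ge 1$ be integers. For a unitary $U\in\mathrm U(N)$ let $\rho(U)=U|0\rangle\langle 0|U^\dagger$ be the corresponding $N$-dimensional pure state. Let $\mathcal X$ be the set of Hermitian matrices $O\in\mathbb C^{N^k\times N^k}$ with $\|O\|_{\mathrm{op}}\le 1$, and let $M=\mathbb R$ with $d(a,b)=|a-b|$. The $k$-copy quantum statistical query oracle of tolerance $\tau$ for a state $\rho$ answers a query $O\in\mathcal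 X$ by some $v$ with $|v-\mathrm{tr}[\rho^{\otimes k}O]|\le\tau$; that is, it is the evaluation oracle of the function $O\mapsto\mathrm{tr}[\rho^{\otimes k}O]$. Let $\mu_{N,k}$ be the law of the function $O\mapsto\mathrm{tr}[\rho(U)^{\otimes k}O]$ when $U$ is drawn from the Haar probability measure on $\mathrm U(N)$. **Theorem.** For all integers $N,k\ge1$ and every real $\tau>0$, $$q_{\mathrm{nt}}[\mu_{N,k},\tau]\;\ge\;\exp\!\left(\frac{N\tau^2}{9\pi^3k^2}\right).$$ -/

import Mathlib

open MeasureTheory Matrix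
open scoped ENNReal ComplexOrder

noncomputable section

/-! ### Non-trivial learning from evaluation queries -/

namespace Learning

variable {X M : Type*} [PseudoMetricSpace M] [MeasurableSpace M]

/-- The maximally distinguishable fraction from the reference function `f`, for sources
`s : X → M` drawn from the probability measure `μ`: the largest probability, over all queries `x`,
that a single query `x` of tolerance `τ` distinguishes `s` from `f`. -/
def frac (μ : Measure (X → M)) (f : X → M) (τ : ℝ) : ℝ≥0∞ :=
  ⨆ x : X, μ {s | τ < dist (s x) (f x)}

/-- The query complexity of non-trivial learning with respect to `μ` from evaluation queries of
tolerance `τ`. It takes values in `[0, ∞]`; the inverse of a vanishing fraction is `∞`. -/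
def qnt (μ : Measure (X → M)) (τ : ℝ) : ℝ≥0∞ :=
  ⨆ f : X → M, (frac μ f τ)⁻¹

end Learning

/-! ### Quantum states, observables, statistical queries -/

namespace Quantum

variable {n : Type*} [Fintype n] [DecidableEq n]

variable (n) in
/-- Quantum states: positive semidefinite complex matrices of trace one. -/
abbrev State : Type _ := {ρ : Matrix n n ℂ // ρ.PosSemidef ∧ ρ.trace = 1}

variable (n) in
/-- Observables: Hermitian complex matrices of (`ℓ²`-induced) operator norm at most one. -/
abbrev Observable : Type _ :=
  {O : Matrix n n ℂ // O.IsHermitian ∧ ‖Matrix.toEuclideanCLM (n := n) (𝕜 := ℂ) O‖ ≤ 1}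

/-- The function on observables `O ↦ tr(ρ O)` attached to a state `ρ`. -/
def State.expect (ρ : State n) (O : Observable n) : ℝ := (ρ.1 * O.1).trace.re

/-- `tr(ρ O)` is real, so taking the real part in `State.expect` loses nothing. -/
theorem State.coe_expect (ρ : State n) (O : Observable n) :
    (ρ.expect O : ℂ) = (ρ.1 * O.1).trace := by
  have h : star (ρ.1 * O.1).trace = (ρ.1 * O.1).trace := by
    rw [← Matrix.trace_conjTranspose, Matrix.conjTranspose_mul, O.2.1.eq, ρ.2.1.1.eq,
      Matrix.trace_mul_comm]
  exact Complex.conj_eq_iff_re.mp h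

/-- The `k`-fold tensor (Kronecker) power of a matrix. The index type `Fin k → n` enumerates the
product basis of the `k`-fold tensor product, of dimension `(card n) ^ k`. -/
def tensorPow {n : Type*} (k : ℕ) (A : Matrix n n ℂ) : Matrix (Fin k → n) (Fin k → n) ℂ :=
  Matrix.of fun i j => ∏ l, A (i l) (j l)

theorem tensorPow_mul {n : Type*} [Fintype n] (k : ℕ) (A B : Matrix n n ℂ) :
    tensorPow k (A * B) = tensorPow k A * tensorPow k B := by
  ext i j
  simp only [tensorPow, Matrix.of_apply, Matrix.mul_apply, ← Finset.prod_mul_distrib]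
  rw [Finset.prod_univ_sum]
  simp

theorem tensorPow_conjTranspose {n : Type*} (k : ℕ) (A : Matrix n n ℂ) :
    tensorPow k Aᴴ = (tensorPow k A)ᴴ := by
  ext i j
  simp [tensorPow, Matrix.conjTranspose_apply]

theorem trace_tensorPow {n : Type*} [Fintype n] (k : ℕ) (A : Matrix n n ℂ) :
    (tensorPow k A).trace = A.trace ^ k := by
  simp only [tensorPow, Matrix.trace, Matrix.diag_apply, Matrix.of_apply]
  have h := Finset.prod_univ_sum (fun _ : Fin k => (Finset.univ : Finset n)) (fun _ i => A i i)
  simp only [Finset.prod_const, Finset.card_univ, Fintype.card_fin, Fintype.piFinset_univ] at h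
  exact h.symm

open scoped MatrixOrder in
theorem posSemidef_tensorPow (k : ℕ) {A : Matrix n n ℂ} (hA : A.PosSemidef) :
    (tensorPow k A).PosSemidef := by
  obtain ⟨B, rfl⟩ := CStarAlgebra.nonneg_iff_eq_star_mul_self.mp hA.nonneg
  rw [Matrix.star_eq_conjTranspose, tensorPow_mul, tensorPow_conjTranspose]
  exact Matrix.posSemidef_conjTranspose_mul_self _

/-- The state `ρ^{⊗k}` of `k` independent copies of `ρ`. -/
def State.copies (k : ℕ) (ρ : State n) : State (Fin k → n) :=
  ⟨tensorPow k ρ.1, posSemidef_tensorPow k ρ.2.1, by rw [trace_tensorPow, ρ.2.2, one_pow]⟩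

/-! ### Haar-random pure states -/

instance : MeasurableSpace (Matrix.unitaryGroup n ℂ) := borel _

instance : BorelSpace (Matrix.unitaryGroup n ℂ) := ⟨rfl⟩

instance : CompactSpace (Matrix.unitaryGroup n ℂ) := by
  refine isCompact_iff_compactSpace.mp ?_
  have hK : IsCompact (Set.univ.pi fun _ : n => Set.univ.pi fun _ : n =>
      Metric.closedBall (0 : ℂ) 1) :=
    isCompact_univ_pi fun _ => isCompact_univ_pi fun _ => isCompact_closedBall 0 1
  refine IsCompact.of_isClosed_subset hK ?_ ?_
  · have h : ((Matrix.unitaryGroup n ℂ : Submonoid (Matrix n n ℂ)) : Set (Matrix n n ℂ)) =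
        {A | A * star A = 1} := by
      ext A; exact Matrix.mem_unitaryGroup_iff
    rw [h]
    exact isClosed_eq (continuous_id.mul continuous_star) continuous_const
  · intro A hA i _ j _
    simpa using entry_norm_bound_of_unitary hA i j

variable (n) in
/-- The Haar probability measure on the unitary group: the left-invariant measure of total
mass one. -/
def haarU : Measure (Matrix.unitaryGroup n ℂ) := Measure.haarMeasure ⊤

instance : IsProbabilityMeasure (haarU n) := ⟨by
  have h := Measure.haarMeasure_self
    (K₀ := (⊤ : TopologicalSpace.PositiveCompacts (Matrix.unitaryGroup n ℂ)))
  rwa [TopologicalSpace.PositiveCompacts.coe_top] at h⟩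

/-- The pure state `ρ(U) = U |0⟩⟨0| U†` in dimension `N`. -/
def pureState {N : ℕ} [NeZero N] (U : Matrix.unitaryGroup (Fin N) ℂ) : State (Fin N) :=
  ⟨U.1 * Matrix.single 0 0 1 * U.1ᴴ, by
    constructor
    · have h : (Matrix.single (0 : Fin N) (0 : Fin N) (1 : ℂ)).PosSemidef := by
        rw [← Matrix.diagonal_single]
        refine Matrix.PosSemidef.diagonal fun i => ?_
        by_cases hi : i = 0 <;> simp [hi]
      exact h.mul_mul_conjTranspose_same _
    · have h : U.1ᴴ * U.1 = 1 := Matrix.mem_unitaryGroup_iff'.mp U.2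
      rw [Matrix.mul_assoc, Matrix.trace_mul_comm, Matrix.mul_assoc, h, Matrix.mul_one]
      simp⟩

/-- The source function of the `k`-copy quantum statistical query oracle: an observable `O` on
`k` copies is mapped to `tr(ρ(U)^{⊗k} O)`. -/
def copiesQuery (N k : ℕ) [NeZero N] (U : Matrix.unitaryGroup (Fin N) ℂ) :
    Observable (Fin k → Fin N) → ℝ :=
  ((pureState U).copies k).expect

theorem measurable_copiesQuery (N k : ℕ) [NeZero N] : Measurable (copiesQuery N k) := by
  refine measurable_pi_lambda _ fun O => Continuous.measurable ?_
  refine Complex.continuous_re.comp (Continuous.matrix_trace ?_)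
  refine Continuous.mul (f := fun U : Matrix.unitaryGroup (Fin N) ℂ =>
    tensorPow k (U.1 * Matrix.single 0 0 1 * U.1ᴴ)) ?_ continuous_const
  have h : Continuous fun U : Matrix.unitaryGroup (Fin N) ℂ =>
      U.1 * Matrix.single 0 0 1 * U.1ᴴ :=
    (continuous_subtype_val.mul continuous_const).mul
      continuous_subtype_val.matrix_conjTranspose
  refine continuous_matrix fun i j => ?_
  simp only [tensorPow, Matrix.of_apply]
  exact continuous_finsetProd _ fun l _ => h.matrix_elem (i l) (j l)

/-- The law of the source function of the `k`-copy oracle for a Haar-random pure state in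
dimension `N`. -/
def haarCopies (N k : ℕ) [NeZero N] : Measure (Observable (Fin k → Fin N) → ℝ) :=
  (haarU (Fin N)).map (copiesQuery N k)

instance (N k : ℕ) [NeZero N] : IsProbabilityMeasure (haarCopies N k) :=
  Measure.isProbabilityMeasure_map (measurable_copiesQuery N k).aemeasurable

end Quantum

end

/-!
Write a Haar-random pure state as `U e` with `e` a basis vector. Every `k`-copy query is the value
at `U e` of a smooth, phase-invariant function `Φ` on `ℂ^N` whose derivative on the unit sphere has
norm at most `2 k` (`norm_fderiv_copiesExpect_le`). It suffices to find, for each query, a reference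
value from which `Φ (U e)` deviates by more than `τ` with probability at most
`exp (-N τ² / (9 π³ k²))`; the reference function collects these values.

The sub-Gaussian tail (`measureReal_le_abs_sub_integral`) is obtained from the invariance of Haar
measure alone, by a rotation argument in the style of Maurey and Pisier.

* For an orthonormal pair `u, v`, the law of `(U u, U v)` does not depend on the pair. Replacing `v`
  by `∑ ± e_j / √(N - 1)` with random signs bounds the exponential moments of the derivative of `Φ`
  at `U u` in the direction `U v` (`integral_exp_fderiv_act_le`).
* The increment of `Φ` along the great circle from `U u` towards `U v` integrates such derivatives,
  each with the same law, so Jensen's inequality bounds its exponential moments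
  (`integral_exp_circ_sub_le`).
* Up to a phase, any two unit vectors lie on such a great circle at angle at most `π / 2`. Taking
  `U e` and `U V e` with `V` independent of `U` compares `Φ (U e)` with an independent copy, hence
  with its mean (`integral_exp_sub_integral_le`).

The resulting bound `2 exp (-B τ²)` with `B = N / (4 π² k²)` has a better exponent than required,
which absorbs the factor `2` when `B τ² ≥ 1`. When `B τ² < 1` the mean may be a bad reference value,
but the mass near it is covered by at most `3 / (B τ²)` intervals of length `2 τ`, and the centre of
the heaviest one serves (`exists_measureReal_lt_abs_sub_le`). In dimension one the state is
deterministic.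
-/

open scoped InnerProductSpace

noncomputable section

namespace Quantum

/-! ### Unitary matrices acting on vectors -/

section Action

variable {n : Type*} [Fintype n] [DecidableEq n]

/-- The action of a unitary matrix on Euclidean space. -/
def act (U : unitaryGroup n ℂ) : EuclideanSpace ℂ n →L[ℂ] EuclideanSpace ℂ n :=
  toEuclideanCLM (n := n) (𝕜 := ℂ) U.1

theorem act_mul (U V : unitaryGroup n ℂ) (v : EuclideanSpace ℂ n) :
    act (U * V) v = act U (act V v) := by
  simp [act]

theorem inner_act_act (U : unitaryGroup n ℂ) (v w : EuclideanSpace ℂ n) :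
    ⟪act U v, act U w⟫_ℂ = ⟪v, w⟫_ℂ := by
  have h : star (toEuclideanCLM (n := n) (𝕜 := ℂ) U.1) * toEuclideanCLM (n := n) (𝕜 := ℂ) U.1
      = 1 := by
    rw [← map_star, ← map_mul, mem_unitaryGroup_iff'.mp U.2, map_one]
  rw [act, ← ContinuousLinearMap.adjoint_inner_right, ← ContinuousLinearMap.star_eq_adjoint,
    ← mul_apply_eq_comp, h, one_apply_eq_self]

theorem norm_act (U : unitaryGroup n ℂ) (v : EuclideanSpace ℂ n) : ‖act U v‖ = ‖v‖ := by
  rw [@norm_eq_sqrt_re_inner ℂ, @norm_eq_sqrt_re_inner ℂ, inner_act_act]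

theorem continuous_act {X : Type*} [TopologicalSpace X] {f : X → unitaryGroup n ℂ}
    {g : X → EuclideanSpace ℂ n} (hf : Continuous f) (hg : Continuous g) :
    Continuous fun x => act (f x) (g x) := by
  have h : Continuous fun x => (f x).1 *ᵥ WithLp.ofLp (g x) :=
    (continuous_subtype_val.comp hf).matrix_mulVec ((PiLp.continuous_ofLp 2 _).comp hg)
  exact (PiLp.continuous_toLp 2 _).comp h

/-- An orthonormal pair extends to an orthonormal basis, with prescribed positions. -/
theorem exists_orthonormalBasis_pair {i j : n} (hij : i ≠ j) {u v : EuclideanSpace ℂ n}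
    (h : Orthonormal ℂ ![u, v]) :
    ∃ b : OrthonormalBasis n ℂ (EuclideanSpace ℂ n), b i = u ∧ b j = v := by
  classical
  let w : n → EuclideanSpace ℂ n := fun l => if l = i then u else v
  have hw : Orthonormal ℂ (({i, j} : Set n).domRestrict w) := by
    let g : ({i, j} : Set n) → Fin 2 := fun l => if l.1 = i then 0 else 1
    have hg : Function.Injective g := by
      rintro ⟨x, hx⟩ ⟨y, hy⟩ hxy
      simp only [Set.mem_insert_iff, Set.mem_singleton_iff] at hx hy
      rcases hx with rfl | rfl <;> rcases hy with rfl | rfl <;> simp_all [g, eq_comm]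
    convert h.comp g hg using 1
    ext1 l
    by_cases hl : l.1 = i <;> simp [w, g, hl, Set.domRestrict]
  obtain ⟨b, hb⟩ := hw.exists_orthonormalBasis_extension_of_card_eq (by simp)
  exact ⟨b, by simpa [w] using hb i (by simp), by simpa [w, hij.symm] using hb j (by simp)⟩

/-- The unitary group acts transitively on orthonormal pairs. -/
theorem exists_act_eq_act_eq {u v u' v' : EuclideanSpace ℂ n}
    (h : Orthonormal ℂ ![u, v]) (h' : Orthonormal ℂ ![u', v']) :
    ∃ V : unitaryGroup n ℂ, act V u = u' ∧ act V v = v' := by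
  obtain ⟨i, j, hij⟩ : ∃ i j : n, i ≠ j := by
    rw [← Fintype.one_lt_card_iff]
    simpa [Nat.lt_iff_add_one_le] using h.linearIndependent.fintype_card_le_finrank
  obtain ⟨b, rfl, rfl⟩ := exists_orthonormalBasis_pair hij h
  obtain ⟨b', rfl, rfl⟩ := exists_orthonormalBasis_pair hij h'
  let e := Unitary.linearIsometryEquiv.symm (b.equiv b' (Equiv.refl n))
  let A : Matrix n n ℂ := (toEuclideanCLM (n := n) (𝕜 := ℂ)).symm e.1
  have hA : A ∈ unitaryGroup n ℂ := by
    rw [mem_unitaryGroup_iff]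
    refine EquivLike.injective (toEuclideanCLM (n := n) (𝕜 := ℂ)) ?_
    rw [map_mul, map_star, StarAlgEquiv.apply_symm_apply, Unitary.mul_star_self_of_mem e.2,
      map_one]
  refine ⟨⟨A, hA⟩, ?_, ?_⟩ <;> simp [act, A, e]

end Action

/-! ### Haar measure on the unitary group -/

section Haar

variable {n : Type*} [Fintype n] [DecidableEq n]

instance : (haarU n).IsHaarMeasure := inferInstanceAs (Measure.haarMeasure ⊤).IsHaarMeasure

instance : SecondCountableTopology (Matrix n n ℂ) :=
  inferInstanceAs (SecondCountableTopology (n → n → ℂ))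

instance : SecondCountableTopology (unitaryGroup n ℂ) :=
  TopologicalSpace.Subtype.secondCountableTopology _

instance : (haarU n).IsMulRightInvariant :=
  ⟨fun g => by
    have : IsProbabilityMeasure ((haarU n).map (· * g)) :=
      Measure.isProbabilityMeasure_map (measurable_mul_const g).aemeasurable
    exact Measure.isHaarMeasure_eq_of_isProbabilityMeasure _ _⟩

theorem _root_.Continuous.integrable_haarU {f : unitaryGroup n ℂ → ℝ} (hf : Continuous f) :
    Integrable f (haarU n) :=
  hf.integrable_of_hasCompactSupport (HasCompactSupport.of_compactSpace f)

/-- The joint law of the images of an orthonormal pair under a Haar-random unitary does not depend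
on the pair. -/
theorem integral_act_pair (f : EuclideanSpace ℂ n → EuclideanSpace ℂ n → ℝ)
    {u v u' v' : EuclideanSpace ℂ n}
    (h : Orthonormal ℂ ![u, v]) (h' : Orthonormal ℂ ![u', v']) :
    ∫ U, f (act U u') (act U v') ∂haarU n = ∫ U, f (act U u) (act U v) ∂haarU n := by
  obtain ⟨V, rfl, rfl⟩ := exists_act_eq_act_eq h h'
  simpa only [act_mul] using
    integral_mul_right_eq_self (μ := haarU n) (fun U => f (act U u) (act U v)) V

end Haar

section

variable {n : Type*} [Fintype n]

/-! ### Great circles -/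

theorem orthonormal_pair {E : Type*} [NormedAddCommGroup E] [InnerProductSpace ℂ E] {u v : E}
    (hu : ‖u‖ = 1) (hv : ‖v‖ = 1) (huv : ⟪u, v⟫_ℂ = 0) : Orthonormal ℂ ![u, v] := by
  have hvu : ⟪v, u⟫_ℂ = 0 := inner_eq_zero_symm.mp huv
  refine ⟨fun i => ?_, fun i j hij => ?_⟩
  · fin_cases i <;> simp [hu, hv]
  · fin_cases i <;> fin_cases j <;> simp_all

/-- The great circle through `u` with initial velocity `v`. -/
def circ (u v : EuclideanSpace ℂ n) (θ : ℝ) : EuclideanSpace ℂ n :=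
  Real.cos θ • u + Real.sin θ • v

theorem hasDerivAt_circ (u v : EuclideanSpace ℂ n) (θ : ℝ) :
    HasDerivAt (circ u v) (circ v (-u) θ) θ := by
  have := ((Real.hasDerivAt_cos θ).smul_const u).add ((Real.hasDerivAt_sin θ).smul_const v)
  refine this.congr_deriv ?_
  simp [circ, add_comm]

theorem continuous_circ (u v : EuclideanSpace ℂ n) : Continuous (circ u v) :=
  continuous_iff_continuousAt.mpr fun θ => (hasDerivAt_circ u v θ).continuousAt

theorem inner_circ {u v : EuclideanSpace ℂ n} (hu : ‖u‖ = 1) (hv : ‖v‖ = 1)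
    (huv : ⟪u, v⟫_ℂ = 0) (s t : ℝ) : ⟪circ u v s, circ u v t⟫_ℂ = Real.cos (s - t) := by
  have hvu : ⟪v, u⟫_ℂ = 0 := inner_eq_zero_symm.mp huv
  simp only [circ, ← Complex.coe_smul, inner_add_left, inner_add_right, inner_smul_left,
    inner_smul_right, huv, hvu, inner_self_eq_norm_sq_to_K, hu, hv, Complex.conj_ofReal,
    Real.cos_sub]
  push_cast
  simp
  ring

theorem orthonormal_circ {u v : EuclideanSpace ℂ n} (huv : Orthonormal ℂ ![u, v]) (θ : ℝ) :
    Orthonormal ℂ ![circ u v θ, circ v (-u) θ] := by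
  have hu : ‖u‖ = 1 := huv.1 0
  have hv : ‖v‖ = 1 := huv.1 1
  have h : ⟪u, v⟫_ℂ = 0 := huv.2 (i := 0) (j := 1) (by simp)
  have e : circ v (-u) θ = circ u v (θ + Real.pi / 2) := by
    simp [circ, Real.cos_add_pi_div_two, Real.sin_add_pi_div_two, add_comm]
  have nrm : ∀ t, ‖circ u v t‖ = 1 := fun t => by
    rw [@norm_eq_sqrt_re_inner ℂ, inner_circ hu hv h]
    simp
  refine orthonormal_pair (nrm θ) (e ▸ nrm _) ?_
  rw [e, inner_circ hu hv h]
  simp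

/-! ### Linear functionals of a random unit vector -/

/-- A real coordinate vector, seen in complex Euclidean space. -/
def realVec (x : n → ℝ) : EuclideanSpace ℂ n := WithLp.toLp 2 fun j => (x j : ℂ)

theorem norm_realVec_sq (x : n → ℝ) : ‖realVec x‖ ^ 2 = ∑ j, x j ^ 2 := by
  simp [realVec, EuclideanSpace.norm_sq_eq]

variable [DecidableEq n]

/-- The sign `±1` encoded by a Boolean. -/
def sgn (b : Bool) : ℝ := if b then 1 else -1

theorem sgn_sq (b : Bool) : sgn b ^ 2 = 1 := by cases b <;> simp [sgn]

/-- Exponential moments of a sum of independent signs with weights `a j`. -/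
theorem sum_exp_sgn_le (a : n → ℝ) :
    ∑ ε : n → Bool, Real.exp (∑ j, sgn (ε j) * a j) ≤
      2 ^ Fintype.card n * Real.exp ((∑ j, a j ^ 2) / 2) := by
  have h : ∑ ε : n → Bool, Real.exp (∑ j, sgn (ε j) * a j) =
      ∏ j, ∑ b : Bool, Real.exp (sgn b * a j) := by
    rw [Finset.prod_univ_sum, Fintype.piFinset_univ]
    exact Finset.sum_congr rfl fun ε _ => Real.exp_sum _ _
  rw [h, Finset.sum_div, Real.exp_sum, ← Finset.card_univ, ← Finset.prod_const,
    ← Finset.prod_mul_distrib]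
  refine Finset.prod_le_prod (fun j _ => by positivity) fun j _ => ?_
  have := Real.cosh_le_exp_half_sq (a j)
  rw [Real.cosh_eq] at this
  simp only [Fintype.sum_bool, sgn]
  norm_num
  linarith

theorem realVec_eq_sum (x : n → ℝ) :
    realVec x = ∑ j, x j • EuclideanSpace.single j (1 : ℂ) := by
  ext i
  simp [realVec, Finset.sum_apply, Pi.single_apply]

theorem apply_act_realVec (ℓ : EuclideanSpace ℂ n →L[ℝ] ℝ) (U : unitaryGroup n ℂ) (x : n → ℝ) :
    ℓ (act U (realVec x)) = ∑ j, x j * ℓ (act U (EuclideanSpace.single j 1)) := by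
  rw [realVec_eq_sum, map_sum, map_sum]
  refine Finset.sum_congr rfl fun j _ => ?_
  rw [← Complex.coe_smul, map_smul, Complex.coe_smul, map_smul, smul_eq_mul]

/-- A real functional of norm at most `L` has coefficients of square sum at most `L ^ 2` along the
orthonormal columns of a unitary; evaluate it at the vector of these coefficients. -/
theorem sum_sq_apply_act_le (ℓ : EuclideanSpace ℂ n →L[ℝ] ℝ) {L : ℝ} (hℓ : ‖ℓ‖ ≤ L)
    (U : unitaryGroup n ℂ) :
    ∑ j, ℓ (act U (EuclideanSpace.single j 1)) ^ 2 ≤ L ^ 2 := by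
  set a : n → ℝ := fun j => ℓ (act U (EuclideanSpace.single j 1))
  have h0 := norm_realVec_sq a
  have h1 : ℓ (act U (realVec a)) = ‖realVec a‖ ^ 2 := by
    rw [apply_act_realVec, h0]
    exact Finset.sum_congr rfl fun j _ => (sq _).symm
  have h2 : ‖realVec a‖ ^ 2 ≤ L * ‖realVec a‖ := by
    rw [← h1, ← norm_act U (realVec a)]
    exact (le_abs_self _).trans (ℓ.le_of_opNorm_le hℓ _)
  have hL : 0 ≤ L := (norm_nonneg ℓ).trans hℓ
  rw [← h0]
  nlinarith [norm_nonneg (realVec a), sq_nonneg (‖realVec a‖ - L)]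

/-- The unit vector with coordinates `±1 / √(card n - 1)` off the index `i` and `0` at `i`. -/
def signVec (i : n) (ε : n → Bool) : EuclideanSpace ℂ n :=
  realVec fun j => sgn (ε j) * if j = i then 0 else (√((Fintype.card n : ℝ) - 1))⁻¹

theorem orthonormal_single_signVec (hn : 1 < Fintype.card n) (i : n) (ε : n → Bool) :
    Orthonormal ℂ ![EuclideanSpace.single i (1 : ℂ), signVec i ε] := by
  have hn' : (0 : ℝ) < (Fintype.card n : ℝ) - 1 := by
    rw [sub_pos]; exact_mod_cast hn
  refine orthonormal_pair (by simp) ?_ ?_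
  · rw [← sq_eq_sq₀ (norm_nonneg _) zero_le_one, signVec, norm_realVec_sq]
    simp only [mul_pow, sgn_sq, one_mul, ite_pow, inv_pow, Real.sq_sqrt hn'.le]
    simp only [ne_eq, OfNat.ofNat_ne_zero, not_false_eq_true, zero_pow]
    rw [Finset.sum_ite, Finset.sum_const_zero, zero_add, Finset.sum_const,
      Finset.filter_ne' Finset.univ i, Finset.card_erase_of_mem (Finset.mem_univ i),
      Finset.card_univ, nsmul_eq_mul, Nat.cast_sub hn.le, Nat.cast_one]
    field_simp
  · simp [signVec, realVec, EuclideanSpace.inner_single_left]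

theorem sum_exp_apply_act_signVec_le (ℓ : EuclideanSpace ℂ n →L[ℝ] ℝ) {L : ℝ} (hℓ : ‖ℓ‖ ≤ L)
    (hn : 1 < Fintype.card n) (U : unitaryGroup n ℂ) (i : n) (s : ℝ) :
    ∑ ε : n → Bool, Real.exp (s * ℓ (act U (signVec i ε))) ≤
      2 ^ Fintype.card n * Real.exp (s ^ 2 * L ^ 2 / (2 * ((Fintype.card n : ℝ) - 1))) := by
  have hn' : (0 : ℝ) < (Fintype.card n : ℝ) - 1 := by
    rw [sub_pos]; exact_mod_cast hn
  set r : ℝ := (√((Fintype.card n : ℝ) - 1))⁻¹ with hr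
  have hr2 : r ^ 2 = ((Fintype.card n : ℝ) - 1)⁻¹ := by rw [hr, inv_pow, Real.sq_sqrt hn'.le]
  set b : n → ℝ := fun j => ℓ (act U (EuclideanSpace.single j 1))
  have hb : ∑ j, b j ^ 2 ≤ L ^ 2 := sum_sq_apply_act_le ℓ hℓ U
  have h := sum_exp_sgn_le fun j => s * ((if j = i then 0 else r) * b j)
  have e : ∀ ε : n → Bool, s * ℓ (act U (signVec i ε)) =
      ∑ j, sgn (ε j) * (s * ((if j = i then 0 else r) * b j)) := fun ε => by
    rw [signVec, apply_act_realVec, Finset.mul_sum]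
    exact Finset.sum_congr rfl fun j _ => by ring
  simp only [e]
  refine h.trans (mul_le_mul_of_nonneg_left (Real.exp_le_exp.mpr ?_) (by positivity))
  have h2 : ∑ j, (s * ((if j = i then 0 else r) * b j)) ^ 2 ≤ ∑ j, s ^ 2 * r ^ 2 * b j ^ 2 := by
    refine Finset.sum_le_sum fun j _ => ?_
    split_ifs
    · rw [zero_mul, mul_zero, zero_pow two_ne_zero]; positivity
    · exact le_of_eq (by ring)
  rw [← Finset.mul_sum] at h2
  calc (∑ j, (s * ((if j = i then 0 else r) * b j)) ^ 2) / 2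
      ≤ (s ^ 2 * r ^ 2 * L ^ 2) / 2 := by gcongr; exact h2.trans (by gcongr)
    _ = s ^ 2 * L ^ 2 / (2 * ((Fintype.card n : ℝ) - 1)) := by rw [hr2]; field_simp

variable {Φ : EuclideanSpace ℂ n → ℝ} {L : ℝ}

theorem continuous_fderiv_act (hΦ : ContDiff ℝ 1 Φ) {X : Type*} [TopologicalSpace X]
    {f : X → unitaryGroup n ℂ} {g h : X → EuclideanSpace ℂ n} (hf : Continuous f)
    (hg : Continuous g) (hh : Continuous h) :
    Continuous fun x => fderiv ℝ Φ (act (f x) (g x)) (act (f x) (h x)) := by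
  have h1 : Continuous fun x => fderiv ℝ Φ (act (f x) (g x)) :=
    (hΦ.continuous_fderiv one_ne_zero).comp (continuous_act hf hg)
  exact h1.clm_apply (continuous_act hf hh)

/-- Averaging over random signs: by invariance, the second vector of the pair may be replaced by
any `signVec`, so that Hoeffding's bound for sums of independent signs applies. -/
theorem integral_exp_fderiv_act_le (hΦ : ContDiff ℝ 1 Φ)
    (hL : ∀ p, ‖p‖ = 1 → ‖fderiv ℝ Φ p‖ ≤ L) {u v : EuclideanSpace ℂ n}
    (huv : Orthonormal ℂ ![u, v]) (s : ℝ) :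
    ∫ U, Real.exp (s * fderiv ℝ Φ (act U u) (act U v)) ∂haarU n ≤
      Real.exp (s ^ 2 * L ^ 2 / (2 * ((Fintype.card n : ℝ) - 1))) := by
  have hn : 1 < Fintype.card n := by
    simpa [Nat.lt_iff_add_one_le] using huv.linearIndependent.fintype_card_le_finrank
  obtain ⟨i⟩ : Nonempty n := Fintype.card_pos_iff.mp (by omega)
  have hc : ∀ w w', Continuous fun U : unitaryGroup n ℂ =>
      Real.exp (s * fderiv ℝ Φ (act U w) (act U w')) := fun w w' =>
    Real.continuous_exp.comp (continuous_const.mul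
      (continuous_fderiv_act hΦ continuous_id continuous_const continuous_const))
  have h1 : ∀ ε, ∫ U, Real.exp (s * fderiv ℝ Φ (act U u) (act U v)) ∂haarU n =
      ∫ U, Real.exp (s * fderiv ℝ Φ (act U (EuclideanSpace.single i 1)) (act U (signVec i ε)))
        ∂haarU n := fun ε =>
    integral_act_pair (fun p q => Real.exp (s * fderiv ℝ Φ p q))
      (orthonormal_single_signVec hn i ε) huv
  have h2 : (2 : ℝ) ^ Fintype.card n *
      ∫ U, Real.exp (s * fderiv ℝ Φ (act U u) (act U v)) ∂haarU n =
      ∫ U, ∑ ε, Real.exp (s * fderiv ℝ Φ (act U (EuclideanSpace.single i 1))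
        (act U (signVec i ε))) ∂haarU n := by
    rw [integral_finsetSum _ fun ε _ => (hc _ _).integrable_haarU, ← Finset.sum_congr rfl
      fun ε _ => h1 ε]
    simp
  refine le_of_mul_le_mul_left ?_ (pow_pos two_pos (Fintype.card n) : (0 : ℝ) < _)
  rw [h2]
  refine (integral_mono (g := fun _ => (2 : ℝ) ^ Fintype.card n *
    Real.exp (s ^ 2 * L ^ 2 / (2 * ((Fintype.card n : ℝ) - 1)))) ?_ (integrable_const _)
    fun U => ?_).trans ?_
  · exact (continuous_finsetSum _ fun ε _ => hc _ _).integrable_haarU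
  · exact sum_exp_apply_act_signVec_le _ (hL _ (by rw [norm_act]; simp)) hn U i s
  · simp

/-! ### Exponential moments of increments -/

/-- The velocity of `Φ` along a great circle moved by `U`. -/
def velocity (Φ : EuclideanSpace ℂ n → ℝ) (u v : EuclideanSpace ℂ n) (U : unitaryGroup n ℂ)
    (θ : ℝ) : ℝ :=
  fderiv ℝ Φ (act U (circ u v θ)) (act U (circ v (-u) θ))

theorem continuous_velocity (hΦ : ContDiff ℝ 1 Φ) (u v : EuclideanSpace ℂ n) :
    Continuous fun p : unitaryGroup n ℂ × ℝ => velocity Φ u v p.1 p.2 :=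
  continuous_fderiv_act hΦ continuous_fst ((continuous_circ u v).comp continuous_snd)
    ((continuous_circ v (-u)).comp continuous_snd)

theorem hasDerivAt_act_circ (hΦ : ContDiff ℝ 1 Φ) (u v : EuclideanSpace ℂ n)
    (U : unitaryGroup n ℂ) (θ : ℝ) :
    HasDerivAt (fun t => Φ (act U (circ u v t))) (velocity Φ u v U θ) θ := by
  have h2 : HasDerivAt (fun t => act U (circ u v t)) (act U (circ v (-u) θ)) θ :=
    ((act U).restrictScalars ℝ).hasFDerivAt.comp_hasDerivAt θ (hasDerivAt_circ u v θ)
  exact ((hΦ.differentiable one_ne_zero).differentiableAt.hasFDerivAt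
      (x := act U (circ u v θ))).comp_hasDerivAt θ h2

/-- The increment of `Φ` along a great circle is the integral of its derivative; Jensen's
inequality and the invariance of the law of orthonormal pairs bound its exponential moments by
those of a single derivative. -/
theorem integral_exp_circ_sub_le (hΦ : ContDiff ℝ 1 Φ)
    (hL : ∀ p, ‖p‖ = 1 → ‖fderiv ℝ Φ p‖ ≤ L) {u v : EuclideanSpace ℂ n}
    (huv : Orthonormal ℂ ![u, v]) (s α : ℝ) :
    ∫ U, Real.exp (s * (Φ (act U (circ u v α)) - Φ (act U u))) ∂haarU n ≤
      Real.exp ((s * α) ^ 2 * L ^ 2 / (2 * ((Fintype.card n : ℝ) - 1))) := by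
  let ν : Measure ℝ := volume.restrict (Set.Icc 0 1)
  have : IsProbabilityMeasure ν := ⟨by simp [ν]⟩
  let G : unitaryGroup n ℂ → ℝ → ℝ := fun U t => (s * α) * velocity Φ u v U (α * t)
  have hα : Continuous fun p : unitaryGroup n ℂ × ℝ => (p.1, α * p.2) := by fun_prop
  have hG : Continuous fun p : unitaryGroup n ℂ × ℝ => Real.exp (G p.1 p.2) :=
    Real.continuous_exp.comp (((continuous_velocity hΦ u v).comp hα).const_mul (s * α))
  have hGU : ∀ U, Continuous (G U) := fun U =>
    ((continuous_velocity hΦ u v).comp (by fun_prop : Continuous fun t => (U, α * t))).const_mul _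
  have hFTC : ∀ U, s * (Φ (act U (circ u v α)) - Φ (act U u)) = ∫ t, G U t ∂ν := fun U => by
    have := intervalIntegral.integral_eq_sub_of_hasDerivAt (a := 0) (b := 1)
      (f := fun t => s * Φ (act U (circ u v (α * t)))) (f' := G U)
      (fun t _ => (((hasDerivAt_act_circ hΦ u v U (α * t)).comp t
        (hasDerivAt_const_mul α)).const_mul s).congr_deriv (by ring))
      ((hGU U).intervalIntegrable 0 1)
    rw [intervalIntegral.integral_of_le zero_le_one, ← integral_Icc_eq_integral_Ioc] at this
    rw [this]
    simp [circ, mul_sub]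
  have hJ : ∀ U, Real.exp (s * (Φ (act U (circ u v α)) - Φ (act U u))) ≤
      ∫ t, Real.exp (G U t) ∂ν := fun U => by
    rw [hFTC]
    exact convexOn_exp.map_integral_le Real.continuous_exp.continuousOn isClosed_univ
      (by simp) (hGU U).integrableOn_Icc (Real.continuous_exp.comp (hGU U)).integrableOn_Icc
  have hGe : Integrable (fun p : unitaryGroup n ℂ × ℝ => Real.exp (G p.1 p.2))
      ((haarU n).prod ν) := by
    have h := hG.continuousOn.integrableOn_compact (μ := (haarU n).prod volume)
      (isCompact_univ.prod (isCompact_Icc (a := (0 : ℝ)) (b := 1)))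
    rwa [IntegrableOn, ← Measure.prod_restrict, Measure.restrict_univ] at h
  have hΦc : ∀ w : EuclideanSpace ℂ n, Continuous fun U => Φ (act U w) := fun w =>
    hΦ.continuous.comp (continuous_act continuous_id continuous_const)
  refine (integral_mono (Continuous.integrable_haarU (Real.continuous_exp.comp
    (((hΦc _).sub (hΦc u)).const_mul s))) hGe.integral_prod_left hJ).trans ?_
  rw [integral_integral_swap hGe]
  refine (integral_mono hGe.integral_prod_right (integrable_const _) fun t =>
    integral_exp_fderiv_act_le hΦ hL (orthonormal_circ huv (α * t)) (s * α)).trans ?_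
  simp

end

section

variable {n : Type*} [Fintype n]

/-! ### Sub-Gaussian concentration for functions of a Haar-random pure state -/

/-- Up to a phase, two unit vectors lie on a great circle with orthonormal complex span, at an
angle of at most `π / 2`. -/
theorem exists_eq_smul_circ {u w : EuclideanSpace ℂ n} (hu : ‖u‖ = 1) (hw : ‖w‖ = 1) :
    (∃ c : ℂ, ‖c‖ = 1 ∧ w = c • u) ∨
      ∃ (c : ℂ) (v : EuclideanSpace ℂ n) (α : ℝ), ‖c‖ = 1 ∧ Orthonormal ℂ ![u, v] ∧
        0 ≤ α ∧ α ≤ Real.pi / 2 ∧ w = c • circ u v α := by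
  set z : ℂ := ⟪u, w⟫_ℂ with hz
  set d : EuclideanSpace ℂ n := w - z • u with hd
  have huu : ⟪u, u⟫_ℂ = 1 := by rw [inner_self_eq_norm_sq_to_K, hu]; simp
  have hud : ⟪u, d⟫_ℂ = 0 := by
    rw [hd, inner_sub_right, inner_smul_right, huu, ← hz]; ring
  have hwd : w = z • u + d := by rw [hd]; abel
  have hn : ‖z‖ ^ 2 + ‖d‖ ^ 2 = 1 := by
    have h : ⟪z • u, d⟫_ℂ = 0 := by rw [inner_smul_left, hud, mul_zero]
    have := norm_add_sq_eq_norm_sq_add_norm_sq_of_inner_eq_zero (z • u) d h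
    rw [← hwd, hw, norm_smul, hu] at this
    nlinarith
  obtain ⟨c, hc, hcz⟩ : ∃ c : ℂ, ‖c‖ = 1 ∧ z = c * (‖z‖ : ℂ) :=
    ⟨Complex.exp (z.arg * Complex.I), Complex.norm_exp_ofReal_mul_I _, by
      rw [mul_comm, Complex.norm_mul_exp_arg_mul_I]⟩
  by_cases h0 : d = 0
  · refine Or.inl ⟨z, ?_, by rw [hwd, h0, add_zero]⟩
    rw [h0, norm_zero] at hn
    nlinarith [norm_nonneg z]
  · have hd0 : ‖d‖ ≠ 0 := norm_ne_zero_iff.mpr h0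
    have hz1 : ‖z‖ ≤ 1 := by nlinarith [norm_nonneg z, sq_nonneg ‖d‖]
    refine Or.inr ⟨c, (star c / ‖d‖ : ℂ) • d, Real.arccos ‖z‖, hc, orthonormal_pair hu ?_ ?_,
      Real.arccos_nonneg _, Real.arccos_le_pi_div_two.mpr (norm_nonneg z), ?_⟩
    · rw [norm_smul, norm_div, norm_star, hc, Complex.norm_real, norm_norm, one_div,
        inv_mul_cancel₀ hd0]
    · rw [inner_smul_right, hud, mul_zero]
    · have hcc : c * star c = 1 := by
        have := Complex.mul_conj' c
        rw [hc] at this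
        simpa using this
      have hs : Real.sin (Real.arccos ‖z‖) = ‖d‖ := by
        rw [Real.sin_arccos, ← hn, add_sub_cancel_left, Real.sqrt_sq (norm_nonneg d)]
      have hdc : (‖d‖ : ℂ) ≠ 0 := by exact_mod_cast hd0
      rw [circ, Real.cos_arccos (by linarith [norm_nonneg z]) hz1, hs, ← Complex.coe_smul,
        ← Complex.coe_smul, smul_add, smul_smul, smul_smul, smul_smul, ← hcz,
        show c * ‖d‖ * (star c / ‖d‖) = c * star c by field_simp, hcc, one_smul]
      exact hwd

variable [DecidableEq n] {Φ : EuclideanSpace ℂ n → ℝ} {L : ℝ}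

theorem integral_exp_sub_le (hΦ : ContDiff ℝ 1 Φ) (hph : ∀ (c : ℂ) u, ‖c‖ = 1 → Φ (c • u) = Φ u)
    (hL : ∀ p, ‖p‖ = 1 → ‖fderiv ℝ Φ p‖ ≤ L) (hn : 1 < Fintype.card n)
    {u w : EuclideanSpace ℂ n} (hu : ‖u‖ = 1) (hw : ‖w‖ = 1) (s : ℝ) :
    ∫ U, Real.exp (s * (Φ (act U w) - Φ (act U u))) ∂haarU n ≤
      Real.exp (s ^ 2 * (Real.pi ^ 2 * L ^ 2 / (8 * ((Fintype.card n : ℝ) - 1)))) := by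
  have hn' : (0 : ℝ) < (Fintype.card n : ℝ) - 1 := by
    rw [sub_pos]; exact_mod_cast hn
  rcases exists_eq_smul_circ hu hw with ⟨c, hc, rfl⟩ | ⟨c, v, α, hc, huv, hα0, hα, rfl⟩
  · simp only [map_smul, hph c _ hc, sub_self, mul_zero, Real.exp_zero]
    simp only [integral_const, probReal_univ, smul_eq_mul, mul_one]
    exact Real.one_le_exp (by positivity)
  · simp only [map_smul, hph c _ hc]
    refine (integral_exp_circ_sub_le hΦ hL huv s α).trans (Real.exp_le_exp.mpr ?_)
    calc (s * α) ^ 2 * L ^ 2 / (2 * ((Fintype.card n : ℝ) - 1))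
        ≤ (s ^ 2 * (Real.pi / 2) ^ 2) * L ^ 2 / (2 * ((Fintype.card n : ℝ) - 1)) := by
          rw [mul_pow]; gcongr
      _ = _ := by field_simp; ring

/-- Comparing a Haar-random state `U e` with the independent copy `(U V) e`, which for each fixed
`V` is the pair `U w`, `U e` with `w = V e`, and centring by Jensen's inequality. -/
theorem integral_exp_sub_integral_le (hΦ : ContDiff ℝ 1 Φ)
    (hph : ∀ (c : ℂ) u, ‖c‖ = 1 → Φ (c • u) = Φ u)
    (hL : ∀ p, ‖p‖ = 1 → ‖fderiv ℝ Φ p‖ ≤ L) (hn : 1 < Fintype.card n)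
    {e : EuclideanSpace ℂ n} (he : ‖e‖ = 1) (s : ℝ) :
    ∫ U, Real.exp (s * (Φ (act U e) - ∫ V, Φ (act V e) ∂haarU n)) ∂haarU n ≤
      Real.exp (s ^ 2 * (Real.pi ^ 2 * L ^ 2 / (8 * ((Fintype.card n : ℝ) - 1)))) := by
  set m := ∫ V, Φ (act V e) ∂haarU n with hm
  set X : unitaryGroup n ℂ → ℝ := fun U => Φ (act U e) with hX
  have hXc : Continuous X := hΦ.continuous.comp (continuous_act continuous_id continuous_const)
  set A := ∫ U, Real.exp (s * X U) ∂haarU n with hA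
  have hexp : ∀ a b : ℝ, Real.exp (s * (a - b)) = Real.exp (s * a) * Real.exp (-(s * b)) :=
    fun a b => by rw [← Real.exp_add]; ring_nf
  have hF : Continuous fun p : unitaryGroup n ℂ × unitaryGroup n ℂ =>
      Real.exp (s * (X (p.1 * p.2) - X p.1)) :=
    Real.continuous_exp.comp (((hXc.comp continuous_mul).sub
      (hXc.comp continuous_fst)).const_mul s)
  have hFi : Integrable (fun p : unitaryGroup n ℂ × unitaryGroup n ℂ =>
      Real.exp (s * (X (p.1 * p.2) - X p.1))) ((haarU n).prod (haarU n)) :=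
    hF.integrable_of_hasCompactSupport (HasCompactSupport.of_compactSpace _)
  have h1 : ∫ V, ∫ U, Real.exp (s * (X (U * V) - X U)) ∂haarU n ∂haarU n ≤
      Real.exp (s ^ 2 * (Real.pi ^ 2 * L ^ 2 / (8 * ((Fintype.card n : ℝ) - 1)))) := by
    refine (integral_mono (g := fun _ =>
      Real.exp (s ^ 2 * (Real.pi ^ 2 * L ^ 2 / (8 * ((Fintype.card n : ℝ) - 1)))))
      hFi.integral_prod_right (integrable_const _) fun V => ?_).trans_eq (by simp)
    simp only [hX, act_mul]
    exact integral_exp_sub_le hΦ hph hL hn he (by rw [norm_act, he]) s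
  have h2 : ∫ V, ∫ U, Real.exp (s * (X (U * V) - X U)) ∂haarU n ∂haarU n =
      A * ∫ U, Real.exp (-(s * X U)) ∂haarU n := by
    rw [← integral_integral_swap hFi, ← integral_const_mul]
    refine integral_congr_ae (Filter.Eventually.of_forall fun U => ?_)
    simp only [hexp]
    rw [integral_mul_const, hA]
    congr 1
    exact integral_mul_left_eq_self (μ := haarU n) (fun V => Real.exp (s * X V)) U
  have h3 : Real.exp (-(s * m)) ≤ ∫ U, Real.exp (-(s * X U)) ∂haarU n := by
    have := convexOn_exp.map_integral_le (μ := haarU n) (f := fun U => -(s * X U))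
      Real.continuous_exp.continuousOn isClosed_univ (by simp)
      (Continuous.integrable_haarU (hXc.const_mul s).neg)
      (Continuous.integrable_haarU (Real.continuous_exp.comp (hXc.const_mul s).neg))
    rwa [integral_neg, integral_const_mul] at this
  calc ∫ U, Real.exp (s * (X U - m)) ∂haarU n = A * Real.exp (-(s * m)) := by
        rw [hA, ← integral_mul_const]
        simp only [hexp]
    _ ≤ A * ∫ U, Real.exp (-(s * X U)) ∂haarU n :=
        mul_le_mul_of_nonneg_left h3 (integral_nonneg fun _ => (Real.exp_pos _).le)
    _ ≤ _ := h2 ▸ h1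

/-- **Lévy's lemma for Haar-random states**: a phase-invariant function with derivative bounded by
`L` on the unit sphere concentrates around its mean. -/
theorem measureReal_le_abs_sub_integral (hΦ : ContDiff ℝ 1 Φ)
    (hph : ∀ (c : ℂ) u, ‖c‖ = 1 → Φ (c • u) = Φ u)
    (hL : ∀ p, ‖p‖ = 1 → ‖fderiv ℝ Φ p‖ ≤ L) (hn : 1 < Fintype.card n)
    {e : EuclideanSpace ℂ n} (he : ‖e‖ = 1) {t : ℝ} (ht : 0 ≤ t) :
    (haarU n).real {U | t ≤ |Φ (act U e) - ∫ V, Φ (act V e) ∂haarU n|} ≤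
      2 * Real.exp (-(2 * ((Fintype.card n : ℝ) - 1) / (Real.pi ^ 2 * L ^ 2) * t ^ 2)) := by
  have hn' : (0 : ℝ) < (Fintype.card n : ℝ) - 1 := by
    rw [sub_pos]; exact_mod_cast hn
  have hXc : Continuous fun U : unitaryGroup n ℂ => Φ (act U e) - ∫ V, Φ (act V e) ∂haarU n :=
    (hΦ.continuous.comp (continuous_act continuous_id continuous_const)).sub continuous_const
  set X : unitaryGroup n ℂ → ℝ := fun U => Φ (act U e) - ∫ V, Φ (act V e) ∂haarU n
  have hc : 0 ≤ Real.pi ^ 2 * L ^ 2 / (4 * ((Fintype.card n : ℝ) - 1)) := by positivity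
  have h : ProbabilityTheory.HasSubgaussianMGF X
      ⟨Real.pi ^ 2 * L ^ 2 / (4 * ((Fintype.card n : ℝ) - 1)), hc⟩ (haarU n) :=
    ⟨fun s => Continuous.integrable_haarU (Real.continuous_exp.comp (hXc.const_mul s)), fun s => by
      refine (integral_exp_sub_integral_le hΦ hph hL hn he s).trans_eq ?_
      congr 1
      change _ = Real.pi ^ 2 * L ^ 2 / (4 * ((Fintype.card n : ℝ) - 1)) * s ^ 2 / 2
      field_simp
      ring⟩
  have e1 : Real.exp (-t ^ 2 / (2 * (Real.pi ^ 2 * L ^ 2 / (4 * ((Fintype.card n : ℝ) - 1))))) =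
      Real.exp (-(2 * ((Fintype.card n : ℝ) - 1) / (Real.pi ^ 2 * L ^ 2) * t ^ 2)) := by
    congr 1
    -- For `L = 0` both exponents vanish, since division by zero returns zero.
    rcases eq_or_ne L 0 with rfl | hL0
    · simp
    · field_simp
      ring
  have h1 : (haarU n).real {U | t ≤ X U} ≤ _ := (h.measure_ge_le ht).trans_eq e1
  have h2 : (haarU n).real {U | t ≤ (-X) U} ≤ _ := (h.neg.measure_ge_le ht).trans_eq e1
  have hsub : {U | t ≤ |X U|} ⊆ {U | t ≤ X U} ∪ {U | t ≤ (-X) U} := fun U hU =>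
    le_abs.mp (show t ≤ |X U| from hU)
  refine (measureReal_mono hsub).trans ((measureReal_union_le _ _).trans ?_)
  linarith

end

/-! ### Expectation values on several copies of a pure state -/

section Tensor

variable {n : Type*} [Fintype n] {k : ℕ}

theorem norm_toLp_prod (w : Fin k → EuclideanSpace ℂ n) :
    ‖(WithLp.toLp 2 fun i => ∏ l, w l (i l) : EuclideanSpace ℂ (Fin k → n))‖ = ∏ l, ‖w l‖ := by
  rw [← sq_eq_sq₀ (norm_nonneg _) (Finset.prod_nonneg fun _ _ => norm_nonneg _),
    EuclideanSpace.norm_sq_eq, ← Finset.prod_pow]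
  simp only [EuclideanSpace.norm_sq_eq, norm_prod, ← Finset.prod_pow]
  rw [Finset.prod_univ_sum, Fintype.piFinset_univ]

variable (n k) in
/-- The tensor product of `k` vectors, as a real-multilinear map. -/
def tensorVec : ContinuousMultilinearMap ℝ (fun _ : Fin k => EuclideanSpace ℂ n)
    (EuclideanSpace ℂ (Fin k → n)) :=
  MultilinearMap.mkContinuous
    { toFun := fun w => WithLp.toLp 2 fun i => ∏ l, w l (i l)
      map_update_add' := fun w l x y => by
        ext i
        simp only [PiLp.add_apply]
        rw [← Finset.mul_prod_erase _ _ (Finset.mem_univ l),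
          ← Finset.mul_prod_erase _ _ (Finset.mem_univ l),
          ← Finset.mul_prod_erase _ _ (Finset.mem_univ l)]
        have h : ∀ z, ∏ a ∈ Finset.univ.erase l, Function.update w l z a (i a) =
            ∏ a ∈ Finset.univ.erase l, w a (i a) := fun z =>
          Finset.prod_congr rfl fun a ha => by
            rw [Function.update_of_ne (Finset.ne_of_mem_erase ha)]
        simp only [h, Function.update_self, PiLp.add_apply, add_mul]
      map_update_smul' := fun w l c x => by
        ext i
        simp only [PiLp.smul_apply]
        rw [← Finset.mul_prod_erase _ _ (Finset.mem_univ l),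
          ← Finset.mul_prod_erase _ _ (Finset.mem_univ l)]
        have h : ∀ z, ∏ a ∈ Finset.univ.erase l, Function.update w l z a (i a) =
            ∏ a ∈ Finset.univ.erase l, w a (i a) := fun z =>
          Finset.prod_congr rfl fun a ha => by
            rw [Function.update_of_ne (Finset.ne_of_mem_erase ha)]
        simp only [h, Function.update_self, PiLp.smul_apply, smul_mul_assoc] }
    1 fun w => by rw [one_mul]; exact (norm_toLp_prod w).le

theorem tensorVec_apply (w : Fin k → EuclideanSpace ℂ n) (i : Fin k → n) :
    tensorVec n k w i = ∏ l, w l (i l) := rfl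

theorem norm_tensorVec (w : Fin k → EuclideanSpace ℂ n) : ‖tensorVec n k w‖ = ∏ l, ‖w l‖ :=
  norm_toLp_prod w

theorem contDiff_tensorVec_diag {m : WithTop ℕ∞} :
    ContDiff ℝ m fun u : EuclideanSpace ℂ n => tensorVec n k fun _ => u :=
  (tensorVec n k).contDiff.comp (contDiff_pi.mpr fun _ => contDiff_id)

variable [DecidableEq n]

/-- The expectation value of `O` in the `k`-copy state of the vector `u`. -/
def copiesExpect (O : Matrix (Fin k → n) (Fin k → n) ℂ) (u : EuclideanSpace ℂ n) : ℝ :=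
  (⟪tensorVec n k fun _ => u, toEuclideanCLM (n := Fin k → n) (𝕜 := ℂ) O
    (tensorVec n k fun _ => u)⟫_ℂ).re

theorem copiesExpect_smul (O : Matrix (Fin k → n) (Fin k → n) ℂ) {c : ℂ} (hc : ‖c‖ = 1)
    (u : EuclideanSpace ℂ n) : copiesExpect O (c • u) = copiesExpect O u := by
  have h : tensorVec n k (fun _ => c • u) = c ^ k • tensorVec n k fun _ => u := by
    ext i
    simp [tensorVec_apply, Finset.prod_mul_distrib]
  rw [copiesExpect, h, map_smul, inner_smul_left, inner_smul_right, ← mul_assoc,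
    Complex.conj_mul', norm_pow, hc]
  simp [copiesExpect]

theorem contDiff_copiesExpect (O : Matrix (Fin k → n) (Fin k → n) ℂ) {m : WithTop ℕ∞} :
    ContDiff ℝ m (copiesExpect (n := n) O) := by
  have h2 : ContDiff ℝ m fun u : EuclideanSpace ℂ n =>
      toEuclideanCLM (n := Fin k → n) (𝕜 := ℂ) O (tensorVec n k fun _ => u) :=
    ((toEuclideanCLM (n := Fin k → n) (𝕜 := ℂ) O).restrictScalars ℝ).contDiff.comp
      contDiff_tensorVec_diag
  exact Complex.reCLM.contDiff.comp (contDiff_tensorVec_diag.inner ℂ h2)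

/-- Each of the `k` tensor factors contributes a unit to the derivative of `u ↦ u^{⊗k}`, and the
expectation value is quadratic in `u^{⊗k}`, whence the factor `2`. -/
theorem norm_fderiv_copiesExpect_le (O : Observable (Fin k → n)) {p : EuclideanSpace ℂ n}
    (hp : ‖p‖ = 1) : ‖fderiv ℝ (copiesExpect (n := n) O.1) p‖ ≤ 2 * k := by
  set A := toEuclideanCLM (n := Fin k → n) (𝕜 := ℂ) O.1 with hA
  have hAO : ‖A‖ ≤ 1 := O.2.2
  set T : EuclideanSpace ℂ n → EuclideanSpace ℂ (Fin k → n) := fun u => tensorVec n k fun _ => u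
  have hT : HasFDerivAt T (fderiv ℝ T p) p :=
    ((contDiff_tensorVec_diag (m := 1)).differentiable one_ne_zero).differentiableAt.hasFDerivAt
  have hTp : ‖T p‖ = 1 := by simp [T, norm_tensorVec, hp]
  have hdT : ∀ q, ‖fderiv ℝ T p q‖ ≤ k * ‖q‖ := fun q => by
    have hc : HasFDerivAt (fun (u : EuclideanSpace ℂ n) (_ : Fin k) => u)
        (ContinuousLinearMap.pi fun _ => ContinuousLinearMap.id ℝ _) p :=
      hasFDerivAt_pi.mpr fun _ => hasFDerivAt_id p
    have h := HasFDerivAt.comp p ((tensorVec n k).hasFDerivAt (x := fun _ => p)) hc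
    rw [h.unique hT |>.symm]
    simp only [ContinuousLinearMap.comp_apply, ContinuousMultilinearMap.linearDeriv_apply]
    refine (norm_sum_le _ _).trans ?_
    refine (Finset.sum_le_card_nsmul _ _ ‖q‖ fun l _ => ?_).trans (by simp)
    rw [norm_tensorVec, ← Finset.mul_prod_erase _ _ (Finset.mem_univ l), Function.update_self,
      Finset.prod_eq_one fun a ha => by
        rw [Function.update_of_ne (Finset.ne_of_mem_erase ha), hp], mul_one]
    simp
  have hAT : HasFDerivAt (fun u => A (T u)) ((A.restrictScalars ℝ).comp (fderiv ℝ T p)) p :=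
    (A.restrictScalars ℝ).hasFDerivAt.comp p hT
  have hd := Complex.reCLM.hasFDerivAt.comp p (hT.inner ℂ hAT)
  have hb : ∀ x, ‖A x‖ ≤ ‖x‖ := fun x => by simpa using A.le_of_opNorm_le hAO x
  refine ContinuousLinearMap.opNorm_le_bound _ (by positivity) fun q => ?_
  have e : fderiv ℝ (copiesExpect (n := n) O.1) p q =
      (⟪T p, A (fderiv ℝ T p q)⟫_ℂ + ⟪fderiv ℝ T p q, A (T p)⟫_ℂ).re := by
    have : copiesExpect (n := n) O.1 = Complex.reCLM ∘ fun u => ⟪T u, A (T u)⟫_ℂ := rfl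
    rw [this, hd.fderiv]
    simp [fderivInnerCLM_apply]
  rw [e]
  calc ‖(⟪T p, A (fderiv ℝ T p q)⟫_ℂ + ⟪fderiv ℝ T p q, A (T p)⟫_ℂ).re‖
      ≤ ‖⟪T p, A (fderiv ℝ T p q)⟫_ℂ + ⟪fderiv ℝ T p q, A (T p)⟫_ℂ‖ := Complex.abs_re_le_norm _
    _ ≤ ‖T p‖ * ‖A (fderiv ℝ T p q)‖ + ‖fderiv ℝ T p q‖ * ‖A (T p)‖ :=
        (norm_add_le _ _).trans (add_le_add (norm_inner_le_norm _ _) (norm_inner_le_norm _ _))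
    _ ≤ 1 * (k * ‖q‖) + (k * ‖q‖) * 1 := by
        rw [hTp]
        gcongr
        · exact (hb _).trans (hdT q)
        · exact hdT q
        · exact (hb _).trans hTp.le
    _ = 2 * k * ‖q‖ := by ring

end Tensor

/-! ### Small deviations -/

/-- A two-sided sub-Gaussian tail bound with constant `2` yields, after a suitable choice of the
centre, a tail bound without the constant. For large `B τ ^ 2` the factor `2` is absorbed into the
exponent; otherwise one of boundedly many intervals of length `2 τ` carries enough mass. -/
theorem exists_measureReal_lt_abs_sub_le {Ω : Type*} [MeasurableSpace Ω] {μ : Measure Ω}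
    [IsProbabilityMeasure μ] {X : Ω → ℝ} (hX : Measurable X) {m B τ : ℝ} (hB : 0 < B) (hτ : 0 < τ)
    (h : ∀ t, 0 ≤ t → μ.real {ω | t ≤ |X ω - m|} ≤ 2 * Real.exp (-(B * t ^ 2))) :
    ∃ f, μ.real {ω | τ < |X ω - f|} ≤ Real.exp (-(B * τ ^ 2 / 7)) := by
  set y := B * τ ^ 2 with hy
  have hy0 : 0 < y := by positivity
  rcases le_or_gt 1 y with h1 | h1
  · have hsub : {ω | τ < |X ω - m|} ⊆ {ω | τ ≤ |X ω - m|} :=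
      fun ω (hω : τ < |X ω - m|) => hω.le
    refine ⟨m, (measureReal_mono hsub).trans ((h τ hτ.le).trans ?_)⟩
    have h2 : (2 : ℝ) ≤ Real.exp (6 / 7) := by
      have := Real.quadratic_le_exp_of_nonneg (x := 6 / 7) (by norm_num)
      norm_num at this ⊢
      linarith
    calc 2 * Real.exp (-y) ≤ Real.exp (6 / 7) * Real.exp (-y) := by gcongr
      _ = Real.exp (6 / 7 - y) := by rw [← Real.exp_add]; ring_nf
      _ ≤ Real.exp (-(y / 7)) := Real.exp_le_exp.mpr (by linarith)
  · -- The interval `[m - Nτ, m + Nτ]` has mass at least `1 / 2` and is covered by `N` intervals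
    -- of length `2 τ`.
    obtain ⟨N, hN1, hN2⟩ : ∃ N : ℕ, 2 ≤ N * y ∧ N * y ≤ 3 := by
      refine ⟨⌈2 / y⌉₊, ?_, ?_⟩
      · have := Nat.le_ceil (2 / y)
        rwa [div_le_iff₀ hy0] at this
      · have := (Nat.ceil_lt_add_one (div_pos two_pos hy0).le).le
        calc (⌈2 / y⌉₊ : ℝ) * y ≤ (2 / y + 1) * y := by gcongr
          _ = 2 + y := by field_simp
          _ ≤ 3 := by linarith
    have hN0 : (0 : ℝ) < N := by
      by_contra hc
      nlinarith
    have hN3 : 2 ≤ (N : ℝ) := by nlinarith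
    have hmass : μ.real {ω | N * τ ≤ |X ω - m|} ≤ 1 / 2 := by
      refine (h _ (by positivity)).trans ?_
      have e : B * (N * τ) ^ 2 = N * (N * y) := by rw [hy]; ring
      have h4 : 4 ≤ N * (N * y) := by nlinarith
      have h5 : (4 : ℝ) ≤ Real.exp 4 := by linarith [Real.add_one_le_exp (4 : ℝ)]
      calc 2 * Real.exp (-(B * (N * τ) ^ 2)) ≤ 2 * Real.exp (-4) := by
            rw [e]; gcongr
        _ ≤ 2 * 4⁻¹ := by rw [Real.exp_neg]; gcongr
        _ = 1 / 2 := by norm_num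
    let c : ℕ → ℝ := fun i => m - N * τ + (2 * i + 1) * τ
    have hcover : {ω | N * τ ≤ |X ω - m|}ᶜ ⊆
        ⋃ i ∈ Finset.range N, {ω | |X ω - c i| ≤ τ} := by
      intro ω hω
      simp only [Set.mem_compl_iff, Set.mem_ofPred_eq, not_le, abs_lt] at hω
      set z := (X ω - m + N * τ) / (2 * τ) with hz
      have hz0 : 0 ≤ z := div_nonneg (by linarith) (by linarith)
      have hzN : z < N := by rw [hz, div_lt_iff₀ (by linarith)]; linarith
      have hXz : X ω = m - N * τ + 2 * τ * z := by rw [hz]; field_simp; ring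
      simp only [Set.mem_iUnion, Finset.mem_range, Set.mem_ofPred_eq, exists_prop]
      refine ⟨⌊z⌋₊, (Nat.floor_lt hz0).mpr hzN, ?_⟩
      have ha := Nat.floor_le hz0
      have hb := Nat.lt_floor_add_one z
      rw [abs_le, hXz]
      constructor <;> simp only [c] <;> nlinarith
    have hsum : 1 / 2 ≤ ∑ i ∈ Finset.range N, μ.real {ω | |X ω - c i| ≤ τ} := by
      have hmeas : MeasurableSet {ω | N * τ ≤ |X ω - m|} :=
        measurableSet_le measurable_const (hX.sub_const m).abs
      have h3 := (measureReal_mono (μ := μ) hcover (measure_ne_top _ _)).trans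
        (measureReal_biUnion_finset_le _ _)
      rw [probReal_compl_eq_one_sub hmeas] at h3
      linarith
    obtain ⟨i, -, hi⟩ : ∃ i ∈ Finset.range N, 1 / (2 * (N : ℝ)) ≤
        μ.real {ω | |X ω - c i| ≤ τ} := by
      refine Finset.exists_le_of_sum_le ?_ ((le_of_eq ?_).trans hsum)
      · exact ⟨0, Finset.mem_range.mpr (by exact_mod_cast hN0)⟩
      · rw [Finset.sum_const, Finset.card_range, nsmul_eq_mul]; field_simp
    refine ⟨c i, ?_⟩
    have hcompl : {ω | τ < |X ω - c i|} = {ω | |X ω - c i| ≤ τ}ᶜ := by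
      ext ω; simp
    have hmeas : MeasurableSet {ω | |X ω - c i| ≤ τ} :=
      measurableSet_le (hX.sub_const _).abs measurable_const
    rw [hcompl, probReal_compl_eq_one_sub hmeas]
    have h7 : y / 7 ≤ 1 / (2 * (N : ℝ)) := by
      rw [div_le_div_iff₀ (by norm_num) (by positivity)]; linarith
    linarith [Real.add_one_le_exp (-(y / 7))]

/-! ### The query complexity bound -/

theorem copiesQuery_eq {N k : ℕ} [NeZero N] (U : unitaryGroup (Fin N) ℂ)
    (O : Observable (Fin k → Fin N)) :
    copiesQuery N k U O = copiesExpect O.1 (act U (EuclideanSpace.single 0 1)) := by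
  have hu : ∀ i, act U (EuclideanSpace.single (0 : Fin N) (1 : ℂ)) i = U.1 i 0 := fun i => by
    simp [act, ofLp_toEuclideanCLM]
  have hρ : ∀ i j, (pureState U).1 i j = U.1 i 0 * star (U.1 j 0) := fun i j => by
    simp [pureState, Matrix.mul_apply, Matrix.single_apply, ite_and]
  rw [copiesQuery, State.expect, copiesExpect, PiLp.inner_apply]
  congr 1
  simp only [State.copies, tensorPow, Matrix.trace, Matrix.diag_apply, Matrix.mul_apply,
    Matrix.of_apply, hρ]
  rw [Finset.sum_comm]
  refine Finset.sum_congr rfl fun i _ => ?_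
  simp only [ofLp_toEuclideanCLM, Matrix.mulVec, dotProduct, RCLike.inner_apply, tensorVec_apply,
    hu, Finset.prod_mul_distrib, map_prod, Finset.sum_mul]
  refine Finset.sum_congr rfl fun j _ => ?_
  simp only [RCLike.star_def]
  ring

/-- In dimension one every query has a deterministic answer; in higher dimension Lévy's lemma
applies with the Lipschitz constant `2 k`. -/
theorem exists_haarU_real_lt_abs_sub_le {N k : ℕ} [NeZero N] (hk : 1 ≤ k) {τ : ℝ} (hτ : 0 < τ)
    (O : Observable (Fin k → Fin N)) :
    ∃ f, (haarU (Fin N)).real {U | τ < |copiesQuery N k U O - f|} ≤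
      Real.exp (-((N : ℝ) * τ ^ 2 / (9 * Real.pi ^ 3 * (k : ℝ) ^ 2))) := by
  have hk0 : (0 : ℝ) < k := by exact_mod_cast hk
  have hπ := Real.pi_pos
  rcases (NeZero.one_le (n := N)).eq_or_lt with h1 | h1
  · subst h1
    refine ⟨copiesQuery 1 k 1 O, ?_⟩
    have hconst : ∀ U, copiesQuery 1 k U O = copiesQuery 1 k 1 O := fun U => by
      have hU : act U (EuclideanSpace.single 0 1) =
          U.1 0 0 • (EuclideanSpace.single (0 : Fin 1) (1 : ℂ)) := by
        ext i
        rw [Subsingleton.elim i 0]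
        simp [act, ofLp_toEuclideanCLM]
      have hn : ‖U.1 0 0‖ = 1 := by
        have := norm_act U (EuclideanSpace.single 0 1)
        rw [hU, norm_smul] at this
        simpa using this
      rw [copiesQuery_eq, copiesQuery_eq, hU, copiesExpect_smul _ hn]
      simp [act]
    simp only [hconst, sub_self, abs_zero, not_lt.mpr hτ.le, Set.ofPred_false,
      measureReal_empty]
    positivity
  · have hn : 1 < Fintype.card (Fin N) := by simpa using h1
    have hN2 : (2 : ℝ) ≤ N := by exact_mod_cast h1
    have hX : Measurable fun U : unitaryGroup (Fin N) ℂ => copiesQuery N k U O :=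
      (measurable_pi_apply O).comp (measurable_copiesQuery N k)
    have hB : (0 : ℝ) < N / (4 * Real.pi ^ 2 * k ^ 2) := by positivity
    obtain ⟨f, hf⟩ := exists_measureReal_lt_abs_sub_le (μ := haarU (Fin N)) hX hB hτ
      (m := ∫ V, copiesExpect O.1 (act V (EuclideanSpace.single 0 1)) ∂haarU (Fin N))
      (fun t ht => by
        simp only [copiesQuery_eq]
        refine (measureReal_le_abs_sub_integral (contDiff_copiesExpect O.1)
          (fun c u hc => copiesExpect_smul O.1 hc u)
          (fun p hp => norm_fderiv_copiesExpect_le O hp) hn (by simp) ht).trans ?_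
        rw [Fintype.card_fin]
        have : (N : ℝ) / (4 * Real.pi ^ 2 * k ^ 2) ≤
            2 * ((N : ℝ) - 1) / (Real.pi ^ 2 * (2 * k) ^ 2) := by
          rw [div_le_div_iff₀ (by positivity) (by positivity)]
          have : 0 ≤ Real.pi ^ 2 * (k : ℝ) ^ 2 * (N - 2) :=
            mul_nonneg (by positivity) (by linarith)
          nlinarith
        gcongr)
    refine ⟨f, hf.trans (Real.exp_le_exp.mpr (neg_le_neg ?_))⟩
    have e : (N : ℝ) / (4 * Real.pi ^ 2 * k ^ 2) * τ ^ 2 / 7 =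
        N * τ ^ 2 / (28 * Real.pi ^ 2 * k ^ 2) := by field_simp; norm_num
    rw [e]
    -- `28 ≤ 9 π`
    have h28 : 28 * Real.pi ^ 2 ≤ 9 * Real.pi ^ 3 := by
      nlinarith [Real.pi_gt_d2, sq_nonneg Real.pi]
    gcongr

end Quantum

end

theorem mainTheorem9 (N k : ℕ) [NeZero N] (hk : 1 ≤ k) (τ : ℝ) (hτ : 0 < τ) :
    ENNReal.ofReal (Real.exp ((N : ℝ) * τ ^ 2 / (9 * Real.pi ^ 3 * (k : ℝ) ^ 2))) ≤
      Learning.qnt (Quantum.haarCopies N k) τ := by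
  choose f hf using fun O => Quantum.exists_haarU_real_lt_abs_sub_le (N := N) hk hτ O
  refine le_iSup_of_le f ?_
  rw [ENNReal.le_inv_iff_le_inv, ← ENNReal.ofReal_inv_of_pos (Real.exp_pos _), ← Real.exp_neg]
  refine iSup_le fun O => ?_
  have hmeas : MeasurableSet {s : Quantum.Observable (Fin k → Fin N) → ℝ |
      τ < dist (s O) (f O)} :=
    measurableSet_lt measurable_const ((measurable_pi_apply O).dist measurable_const)
  rw [Quantum.haarCopies, Measure.map_apply (Quantum.measurable_copiesQuery N k) hmeas,
    ← ofReal_measureReal]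
  exact ENNReal.ofReal_le_ofReal (hf O)
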